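/- Let $X$ be a (real or complex) Banach space with closed dual unit ball $B_{X^*}$, regarded as a subspace of its bidual $X^{**}$. For a bounded sequence $(x_n)$ in $X$ (or of scalars) put $\operatorname{ca}(x_n)=\inf_{n}\operatorname{diam}\{x_k:\ k\ge n\}$; for a bounded sequence $(x_n)$ in $X$ put $$\delta(x_n)=\sup\{\operatorname{ca}(x^*(x_n)):\ x^*\in B_{X^*}\},\qquad \widetilde\delta(x_n)=\inf\{\delta(x_{n_k}):\ (n_k)\text{ strictly increasing}\},$$ and let $\operatorname{clust}(x_n)$ be the set of all cluster points of $(x_n)$ in $(X^{**},w^*)$. For $A\subset X$ bounded put $$\beta_w(A)=\sup\{\widetilde\delta(x_n):\ (x_n)\text{ a sequence in }A\},$$ $$\operatorname{wck}(A)=\sup\{\operatorname{dist}(\operatorname{clust}(x_n),X):\ (x_n)\text{ a sequence in }A\},$$ $$\omega(A)=\inf\Big\{\sup_{a\in A}\operatorname{dist}(a,K):\ \emptyset\ne K\subset X\text{ weakly compact}\Big\},$$ $$\chi(A)=\inf\Big\{\sup_{a\in A}\operatorname{dist}(a,F):\ \emptyset\ne F\subset X\text{ finite}\Big\},$$ where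 $\operatorname{dist}(S,T)=\inf\{\|s-t\|:\ s\in S,\ t\in T\}$ (with the norm of $X^{**}$ in the definition of $\operatorname{wck}$), and suprema over the empty set are $0$. Two such quantities $p,q$ are called equivalent if there is a constant $C>0$ such that $p(A)\le C\,q(A)$ and $q(A)\le C\,p(A)$ for every bounded set $A\subset X$. Then the quantities $\beta_w$, $\operatorname{wck}$, $\omega$ and $\chi$ are pairwise equivalent if and only if $X$ has the quantitative Schur property, i.e. there is a constant $c>0$ such that $\operatorname{ca}(x_n)\le c\,\delta(x_n)$ for every bounded sequence $(x_n)$ in $X$. -/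

import Mathlib

open Filter
open scoped ENNReal NNReal

noncomputable section

namespace QuantSchur

section Metric

variable {Y : Type*} [PseudoEMetricSpace Y]

/-- The excess of `A` from `B`, the supremum over `a ∈ A` of the distance from `a` to `B`. All
quantities below are computed in `[0, ∞]`; they are finite on bounded sets and sequences. -/
def excess (A B : Set Y) : ℝ≥0∞ := ⨆ a ∈ A, Metric.infEDist a B

/-- The distance of two sets, the infimum of the distances of their points. -/
def setDist (A B : Set Y) : ℝ≥0∞ := ⨅ a ∈ A, Metric.infEDist a B

/-- The oscillation `ca (x_n) = inf_n diam {x_k : k ≥ n}` of a sequence. -/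
def ca (x : ℕ → Y) : ℝ≥0∞ := ⨅ n, Metric.ediam (x '' Set.Ici n)

/-- The Hausdorff measure of non-compactness `χ`. -/
def hausdorffMeasure (A : Set Y) : ℝ≥0∞ :=
  ⨅ (F : Set Y) (_ : F.Nonempty ∧ F.Finite), excess A F

end Metric

variable (𝕜 : Type*) [RCLike 𝕜] {X : Type*} [NormedAddCommGroup X] [NormedSpace 𝕜 X]

/-- The De Blasi measure of weak non-compactness `ω`. -/
def deBlasi (A : Set X) : ℝ≥0∞ :=
  ⨅ (K : Set X) (_ : K.Nonempty ∧ IsCompact (toWeakSpace 𝕜 X '' K)), excess A K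

/-- The measure of weak non-Cauchyness `δ (x_n) = sup {ca (x* (x_n)) : x* ∈ B_{X*}}`. -/
def delta (x : ℕ → X) : ℝ≥0∞ :=
  ⨆ f ∈ Metric.closedBall (0 : StrongDual 𝕜 X) 1, ca fun n => f (x n)

/-- The infimum of `δ` over all subsequences. -/
def deltaTilde (x : ℕ → X) : ℝ≥0∞ :=
  ⨅ (φ : ℕ → ℕ) (_ : StrictMono φ), delta 𝕜 (x ∘ φ)

/-- The measure of weak non-precompactness `β_w`. -/
def betaW (A : Set X) : ℝ≥0∞ :=
  ⨆ (x : ℕ → X) (_ : ∀ n, x n ∈ A), deltaTilde 𝕜 x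

/-- The set of all cluster points of the sequence `x` in the bidual `X**` with the
weak* topology. It is a set of elements of the normed space `X**`. -/
def clust (x : ℕ → X) : Set (StrongDual 𝕜 (StrongDual 𝕜 X)) :=
  {z | MapClusterPt (StrongDual.toWeakDual z) atTop
    fun n => StrongDual.toWeakDual (NormedSpace.inclusionInDoubleDual 𝕜 X (x n))}

/-- The measure of weak non-compactness `wck`, with distances taken in the norm of `X**`. -/
def wck (A : Set X) : ℝ≥0∞ :=
  ⨆ (x : ℕ → X) (_ : ∀ n, x n ∈ A),
    setDist (clust 𝕜 x) (Set.range (NormedSpace.inclusionInDoubleDual 𝕜 X))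

variable (X) in
/-- The `c`-Schur property. -/
def HasSchurConst (c : ℝ≥0) : Prop :=
  ∀ x : ℕ → X, Bornology.IsBounded (Set.range x) → ca x ≤ c * delta 𝕜 x

variable (X) in
/-- The quantitative Schur property: the `c`-Schur property for some `c > 0`. -/
def HasQuantitativeSchur : Prop := ∃ c : ℝ≥0, 0 < c ∧ HasSchurConst 𝕜 X c

/-- Equivalence, up to multiplicative constants, of two quantities defined on the bounded
subsets of `X`. -/
def Equivalent (p q : Set X → ℝ≥0∞) : Prop :=
  ∃ C : ℝ≥0, 0 < C ∧ ∀ A : Set X, Bornology.IsBounded A → p A ≤ C * q A ∧ q A ≤ C * p A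

end QuantSchur

end

namespace QuantSchur

open scoped Topology

section Metric

variable {Y : Type*} [PseudoEMetricSpace Y]

/-! On bounded sets `betaW ≤ 8 * wck ≤ 8 * deBlasi ≤ 8 * hausdorffMeasure` holds in every space, so
all four quantities are equivalent once `hausdorffMeasure ≤ c * betaW`. The Schur inequality gives
this, since a separated sequence has large `ca`, hence large `delta`, along every subsequence.
Conversely, `ca x ≤ delta x + 4 * hausdorffMeasure (range x)` and `betaW (range x) ≤ delta x` always
hold, so `hausdorffMeasure ≤ C * betaW` yields the Schur constant `1 + 4 * C`. The hard link is
`betaW_le_wck`: countably many functionals norm the span of a sequence, and a subsequence on which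
they all converge forces its weak* cluster points to be close. -/

theorem ca_comp_le_of_tendsto {x : ℕ → Y} {m : ℕ → ℕ} (hm : Tendsto m atTop atTop) :
    ca (x ∘ m) ≤ ca x := by
  refine le_iInf fun N => ?_
  obtain ⟨M, hM⟩ := eventually_atTop.1 (hm.eventually_ge_atTop N)
  refine (iInf_le _ M).trans (Metric.ediam_mono ?_)
  rintro _ ⟨n, hn, rfl⟩
  exact ⟨m n, hM n hn, rfl⟩

theorem ca_le_of_forall_edist_le {x : ℕ → Y} {r : ℝ≥0∞} (N : ℕ)
    (h : ∀ i ≥ N, ∀ j ≥ N, edist (x i) (x j) ≤ r) : ca x ≤ r := by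
  refine (iInf_le _ N).trans (Metric.ediam_le ?_)
  rintro _ ⟨i, hi, rfl⟩ _ ⟨j, hj, rfl⟩
  exact h i hi j hj

theorem le_ca_of_forall_exists {x : ℕ → Y} {r : ℝ≥0∞}
    (h : ∀ N, ∃ i ≥ N, ∃ j ≥ N, r ≤ edist (x i) (x j)) : r ≤ ca x := by
  refine le_iInf fun N => ?_
  obtain ⟨i, hi, j, hj, hr⟩ := h N
  exact hr.trans (Metric.edist_le_ediam_of_mem ⟨i, hi, rfl⟩ ⟨j, hj, rfl⟩)

theorem exists_lt_edist_of_lt_ca {x : ℕ → Y} {r : ℝ≥0∞} (h : r < ca x) (N : ℕ) :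
    ∃ i ≥ N, ∃ j ≥ N, r < edist (x i) (x j) := by
  by_contra! hc
  exact h.not_ge (ca_le_of_forall_edist_le N hc)

/-- Greedy choice: finitely many points never cover `A` up to `r`. The extra point `y₀` keeps the
finite set nonempty at the first step. -/
theorem exists_separated_seq {A : Set Y} {r : ℝ≥0∞} [Nonempty Y] (h : r < hausdorffMeasure A) :
    ∃ x : ℕ → Y, (∀ n, x n ∈ A) ∧ ∀ m n, m < n → r ≤ edist (x m) (x n) := by
  refine exists_seq_of_forall_finset_exists (· ∈ A) (fun a b => r ≤ edist a b) fun s _ => ?_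
  obtain ⟨y₀⟩ := ‹Nonempty Y›
  have hF : r < excess A (insert y₀ (s : Set Y)) :=
    h.trans_le (iInf₂_le _ ⟨Set.insert_nonempty _ _, s.finite_toSet.insert _⟩)
  obtain ⟨a, ha'⟩ := lt_iSup_iff.1 hF
  obtain ⟨haA, ha⟩ := lt_iSup_iff.1 ha'
  refine ⟨a, haA, fun y hy => ?_⟩
  rw [edist_comm]
  exact ha.le.trans (Metric.infEDist_le_edist_of_mem (Set.mem_insert_of_mem _ hy))

end Metric

variable {𝕜 : Type*} [RCLike 𝕜] {X : Type*} [NormedAddCommGroup X] [NormedSpace 𝕜 X]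

/-! ### The Schur inequality against `betaW` and `hausdorffMeasure` -/

theorem edist_apply_le {E : Type*} [SeminormedAddCommGroup E] [NormedSpace 𝕜 E]
    {f : StrongDual 𝕜 E} (hf : ‖f‖ ≤ 1) (x y : E) : edist (f x) (f y) ≤ edist x y := by
  rw [edist_dist, edist_dist, dist_eq_norm, dist_eq_norm, ← map_sub]
  exact ENNReal.ofReal_le_ofReal ((f.le_of_opNorm_le hf _).trans_eq (one_mul _))

theorem ca_apply_le_delta (x : ℕ → X) {f : StrongDual 𝕜 X} (hf : ‖f‖ ≤ 1) :
    ca (fun n => f (x n)) ≤ delta 𝕜 x :=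
  le_iSup₂_of_le f (mem_closedBall_zero_iff.2 hf) le_rfl

theorem delta_comp_le_of_tendsto {x : ℕ → X} {m : ℕ → ℕ} (hm : Tendsto m atTop atTop) :
    delta 𝕜 (x ∘ m) ≤ delta 𝕜 x :=
  iSup₂_mono fun f _ => ca_comp_le_of_tendsto (x := fun n => f (x n)) hm

theorem deltaTilde_le_betaW {A : Set X} {x : ℕ → X} (hx : ∀ n, x n ∈ A) :
    deltaTilde 𝕜 x ≤ betaW 𝕜 A :=
  le_iSup₂_of_le x hx le_rfl

theorem HasSchurConst.hausdorffMeasure_le_betaW {c : ℝ≥0} (hc : 0 < c) (h : HasSchurConst 𝕜 X c)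
    {A : Set X} (hA : Bornology.IsBounded A) : hausdorffMeasure A ≤ c * betaW 𝕜 A := by
  refine le_of_forall_lt fun r hr => ?_
  obtain ⟨r', hrr', hr'⟩ := exists_between hr
  obtain ⟨x, hxA, hx⟩ := exists_separated_seq hr'
  have key : r' ≤ c * deltaTilde 𝕜 x := by
    have hc' : (c : ℝ≥0∞) ≠ 0 := by exact_mod_cast hc.ne'
    simp_rw [deltaTilde, ENNReal.mul_iInf_of_ne hc' ENNReal.coe_ne_top]
    refine le_iInf₂ fun φ hφ => le_trans ?_
      (h (x ∘ φ) (hA.subset (Set.range_subset_iff.2 fun n => hxA _)))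
    exact le_ca_of_forall_exists fun N =>
      ⟨N, le_rfl, N + 1, N.le_succ, hx _ _ (hφ N.lt_succ_self)⟩
  exact hrr'.trans_le (key.trans (mul_le_mul_right (deltaTilde_le_betaW hxA) _))

theorem betaW_range_le_delta (x : ℕ → X) : betaW 𝕜 (Set.range x) ≤ delta 𝕜 x := by
  refine iSup₂_le fun y hy => ?_
  choose m hm using hy
  -- Either the indices tend to infinity, or one recurs infinitely often and yields a constant
  -- subsequence.
  by_cases hfin : ∀ v, {n | m n = v}.Finite
  · have hm' : Tendsto m atTop atTop := by
      rw [← Nat.cofinite_eq_atTop]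
      exact Tendsto.cofinite_of_finite_preimage_singleton hfin
    refine (iInf₂_le id strictMono_id).trans ?_
    have : y ∘ id = x ∘ m := funext fun n => (hm n).symm
    rw [this]
    exact delta_comp_le_of_tendsto hm'
  · push Not at hfin
    obtain ⟨v, hv⟩ := hfin
    obtain ⟨φ, hφ, hφv⟩ := extraction_of_frequently_atTop (Nat.frequently_atTop_iff_infinite.2 hv)
    refine (iInf₂_le φ hφ).trans (iSup₂_le fun f _ => ?_)
    refine (ca_le_of_forall_edist_le (r := 0) 0 fun i _ j _ => ?_).trans zero_le
    simp [← hm, hφv]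

/-- A functional norming `a - b` oscillates by almost `edist a b` on every tail, since each tail
comes within `s` of both points. -/
theorem edist_le_delta_add {x : ℕ → X} {a b : X} {s : ℝ≥0∞}
    (ha : ∃ᶠ n in atTop, edist (x n) a ≤ s) (hb : ∃ᶠ n in atTop, edist (x n) b ≤ s) :
    edist a b ≤ delta 𝕜 x + 2 * s := by
  obtain ⟨f, hf, hfab⟩ := exists_dual_vector'' 𝕜 (a - b)
  have hab : edist a b = edist (f a) (f b) := by
    rw [edist_dist, edist_dist, dist_eq_norm, dist_eq_norm, ← map_sub, hfab]
    simp
  refine le_trans ?_ (add_le_add_left (ca_apply_le_delta x hf) _)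
  rw [ca, ENNReal.iInf_add, hab]
  refine le_iInf fun N => ?_
  obtain ⟨i, hi, hia⟩ := (frequently_atTop.1 ha) N
  obtain ⟨j, hj, hjb⟩ := (frequently_atTop.1 hb) N
  calc edist (f a) (f b)
      ≤ edist (f a) (f (x i)) + edist (f (x i)) (f (x j)) + edist (f (x j)) (f b) :=
        edist_triangle4 _ _ _ _
    _ ≤ s + Metric.ediam ((fun n => f (x n)) '' Set.Ici N) + s := by
        gcongr
        · rw [edist_comm]
          exact (edist_apply_le hf _ _).trans hia
        · exact Metric.edist_le_ediam_of_mem ⟨i, hi, rfl⟩ ⟨j, hj, rfl⟩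
        · exact (edist_apply_le hf _ _).trans hjb
    _ = _ := by ring

theorem ca_le_delta_add_hausdorffMeasure (x : ℕ → X) :
    ca x ≤ delta 𝕜 x + 4 * hausdorffMeasure (Set.range x) := by
  have h4 : (4 : ℝ≥0∞) ≠ 0 := four_ne_zero
  simp_rw [hausdorffMeasure, ENNReal.mul_iInf_of_ne h4 ENNReal.ofNat_ne_top, ENNReal.add_iInf]
  refine le_iInf₂ fun F hF => ?_
  set s := excess (Set.range x) F
  have hs : ∀ n, ∃ a ∈ F, edist (x n) a ≤ s := fun n => by
    obtain ⟨a, haF, ha⟩ := hF.2.isCompact.exists_infEDist_eq_edist hF.1 (x n)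
    exact ⟨a, haF, ha ▸ le_iSup₂_of_le (x n) ⟨n, rfl⟩ le_rfl⟩
  choose g hgF hg using hs
  -- Net points used only finitely often are finite in number, so they disappear from some tail.
  have hev : ∀ᶠ n in atTop, ∃ᶠ k in atTop, g k = g n := by
    have : ∀ᶠ n in atTop, ∀ a ∈ F, (¬ ∃ᶠ k in atTop, g k = a) → g n ≠ a :=
      (eventually_all_finite hF.2).2 fun a _ => by
        by_cases ha : ∃ᶠ k in atTop, g k = a
        · exact Eventually.of_forall fun n hn => absurd ha hn
        · exact (not_frequently.1 ha).mono fun n hn _ => hn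
    filter_upwards [this] with n hn
    by_contra hc
    exact hn (g n) (hgF n) hc rfl
  obtain ⟨N, hN⟩ := eventually_atTop.1 hev
  refine ca_le_of_forall_edist_le N fun i hi j hj => ?_
  have hij : edist (g i) (g j) ≤ delta 𝕜 x + 2 * s :=
    edist_le_delta_add ((hN i hi).mono fun k hk => hk ▸ hg k)
      ((hN j hj).mono fun k hk => hk ▸ hg k)
  calc edist (x i) (x j) ≤ edist (x i) (g i) + edist (g i) (g j) + edist (g j) (x j) :=
        edist_triangle4 _ _ _ _
    _ ≤ s + (delta 𝕜 x + 2 * s) + s := by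
        gcongr
        · exact hg i
        · rw [edist_comm]; exact hg j
    _ = delta 𝕜 x + 4 * s := by ring

theorem hasQuantitativeSchur_of_equivalent
    (h : Equivalent (betaW 𝕜 (X := X)) hausdorffMeasure) : HasQuantitativeSchur 𝕜 X := by
  obtain ⟨C, -, hC⟩ := h
  refine ⟨1 + 4 * C, by positivity, fun x hx => ?_⟩
  calc ca x ≤ delta 𝕜 x + 4 * hausdorffMeasure (Set.range x) := ca_le_delta_add_hausdorffMeasure x
    _ ≤ delta 𝕜 x + 4 * (C * delta 𝕜 x) := by
        gcongr
        exact (hC _ hx).2.trans (mul_le_mul_right (betaW_range_le_delta x) _)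
    _ = ((1 + 4 * C : ℝ≥0) : ℝ≥0∞) * delta 𝕜 x := by push_cast; ring

/-! ### Weak* cluster points and the chain of inequalities -/

theorem deBlasi_le_hausdorffMeasure (A : Set X) : deBlasi 𝕜 A ≤ hausdorffMeasure A :=
  le_iInf₂ fun F hF => iInf₂_le F ⟨hF.1, (hF.2.image _).isCompact⟩

theorem exists_tendsto_toWeakDual {x : ℕ → X} (hx : Bornology.IsBounded (Set.range x))
    (U : Ultrafilter ℕ) : ∃ z : StrongDual 𝕜 (StrongDual 𝕜 X),
      Tendsto (fun n => StrongDual.toWeakDual (NormedSpace.inclusionInDoubleDual 𝕜 X (x n))) U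
        (𝓝 (StrongDual.toWeakDual z)) := by
  obtain ⟨R, hR⟩ := isBounded_iff_forall_norm_le.1 hx
  obtain ⟨z, -, hz⟩ := (WeakDual.isCompact_closedBall
    (0 : StrongDual 𝕜 (StrongDual 𝕜 X)) R).ultrafilter_le_nhds
    (U.map fun n => StrongDual.toWeakDual (NormedSpace.inclusionInDoubleDual 𝕜 X (x n))) (by
      rw [le_principal_iff]
      refine Ultrafilter.mem_map.2 (univ_mem' fun n => ?_)
      exact mem_closedBall_zero_iff.2
        ((NormedSpace.double_dual_bound 𝕜 X (x n)).trans (hR _ ⟨n, rfl⟩)))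
  exact ⟨WeakDual.toStrongDual z, hz⟩

theorem mapClusterPt_of_mem_clust {x : ℕ → X} {z : StrongDual 𝕜 (StrongDual 𝕜 X)}
    (hz : z ∈ clust 𝕜 x) (f : StrongDual 𝕜 X) :
    MapClusterPt (z f) atTop fun n => f (x n) :=
  MapClusterPt.tendsto_comp (f := fun w : WeakDual 𝕜 (StrongDual 𝕜 X) => w f)
    ((WeakDual.eval_continuous f).tendsto (StrongDual.toWeakDual z)) hz

theorem eq_of_mem_clust_of_tendsto {x : ℕ → X} {z : StrongDual 𝕜 (StrongDual 𝕜 X)}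
    (hz : z ∈ clust 𝕜 x) {f : StrongDual 𝕜 X} {a : 𝕜}
    (h : Tendsto (fun n => f (x n)) atTop (𝓝 a)) : z f = a :=
  eq_of_nhds_neBot ((mapClusterPt_of_mem_clust hz f).neBot.mono (inf_le_inf_left _ h))

theorem wck_le_deBlasi {A : Set X} (hA : Bornology.IsBounded A) : wck 𝕜 A ≤ deBlasi 𝕜 A := by
  refine iSup₂_le fun x hx => le_iInf₂ fun K hK =>
    le_of_forall_gt_imp_ge_of_dense fun s hs => ?_
  induction s with
  | top => exact le_top
  | coe s =>
  have hk : ∀ n, ∃ k ∈ K, edist (x n) k < s := fun n =>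
    Metric.infEDist_lt_iff.1 ((le_iSup₂_of_le (x n) (hx n) le_rfl).trans_lt hs)
  choose k hkK hxk using hk
  -- Along one ultrafilter `x n` tends weak* to `z` and `k n` weakly to `y`; the bound `s` on `‖x n
  -- - k n‖` passes to the limit functional by functional.
  let U : Ultrafilter ℕ := hyperfilter ℕ
  have hU : (U : Filter ℕ) ≤ atTop := Nat.hyperfilter_le_atTop
  obtain ⟨z, hz⟩ := exists_tendsto_toWeakDual (𝕜 := 𝕜)
    (hA.subset (Set.range_subset_iff.2 hx)) U
  obtain ⟨_, ⟨y, -, rfl⟩, hy⟩ := hK.2.ultrafilter_le_nhds (U.map fun n => toWeakSpace 𝕜 X (k n))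
    (le_principal_iff.2 (Ultrafilter.mem_map.2
      (univ_mem' fun n => Set.mem_image_of_mem _ (hkK n))))
  have hclust : z ∈ clust 𝕜 x := hz.mapClusterPt.mono hU
  refine (iInf₂_le z hclust).trans
    ((Metric.infEDist_le_edist_of_mem (Set.mem_range_self y)).trans ?_)
  rw [edist_nndist, ENNReal.coe_le_coe, ← NNReal.coe_le_coe, coe_nndist, dist_eq_norm]
  refine ContinuousLinearMap.opNorm_le_bound _ s.2 fun f => ?_
  have h₁ : Tendsto (fun n => f (x n)) U (𝓝 (z f)) :=
    ((WeakDual.eval_continuous f).tendsto (StrongDual.toWeakDual z)).comp hz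
  have h₂ : Tendsto (fun n => f (k n)) U (𝓝 (f y)) :=
    ((WeakBilin.eval_continuous (topDualPairing 𝕜 X).flip f).tendsto (toWeakSpace 𝕜 X y)).comp hy
  refine le_of_tendsto (h₁.sub h₂).norm (Eventually.of_forall fun n => ?_)
  have hn : ‖x n - k n‖ ≤ s := by
    have := (hxk n).le
    rwa [edist_nndist, ENNReal.coe_le_coe, ← NNReal.coe_le_coe, coe_nndist, dist_eq_norm] at this
  rw [← map_sub, mul_comm]
  exact (f.le_opNorm _).trans (by gcongr)

/-- If a point `p` of `X` is close to a weak* cluster point of a sequence in a subspace `Y`,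
then it is close to `Y` itself. -/
theorem exists_mem_norm_sub_lt {Y : Submodule 𝕜 X} {x : ℕ → X} (hx : ∀ n, x n ∈ Y)
    {z : StrongDual 𝕜 (StrongDual 𝕜 X)} (hz : z ∈ clust 𝕜 x) {p : X} {s : ℝ}
    (h : ‖z - NormedSpace.inclusionInDoubleDual 𝕜 X p‖ < s) : ∃ v ∈ Y, ‖p - v‖ < s := by
  -- Pulled back from the quotient by `Y`, `g` vanishes on every `x n`, hence `z` kills it, while
  -- its value at `p` is the distance from `p` to `Y`.
  obtain ⟨g, hg, hgp⟩ := exists_dual_vector'' 𝕜 (Y.mkQ p)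
  have hqle : ‖Y.mkQL‖ ≤ 1 :=
    ContinuousLinearMap.opNorm_le_bound _ zero_le_one fun v => by
      simpa using Submodule.Quotient.norm_mk_le (S := Y) v
  let f : StrongDual 𝕜 X := g.comp Y.mkQL
  have hf : ‖f‖ ≤ 1 := (g.opNorm_comp_le _).trans (mul_le_one₀ hg (norm_nonneg _) hqle)
  have hfY : ∀ v ∈ Y, f v = 0 := fun v hv => by
    have : Y.mkQ v = 0 := by simpa using hv
    simp [f, this]
  have hzf : z f = 0 := eq_of_mem_clust_of_tendsto hz (by simp [hfY _ (hx _)])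
  have hq : ‖Y.mkQ p‖ < s := by
    refine lt_of_le_of_lt ?_ h
    have h₁ : ‖(z - NormedSpace.inclusionInDoubleDual 𝕜 X p) f‖ = ‖Y.mkQ p‖ := by
      have : f p = ‖Y.mkQ p‖ := hgp
      simp [hzf, this]
    rw [← h₁]
    exact (ContinuousLinearMap.le_of_opNorm_le_of_le _ le_rfl hf).trans_eq (mul_one _)
  obtain ⟨m, hm, hmlt⟩ := Submodule.Quotient.norm_mk_lt (Y.mkQ p) (sub_pos.2 hq)
  refine ⟨p - m, ?_, ?_⟩
  · rw [← Submodule.Quotient.mk_eq_zero, Submodule.Quotient.mk_sub, hm]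
    simp
  · rw [sub_sub_cancel]
    linarith

theorem exists_mem_clust_norm_sub_lt {A : Set X} {s : ℝ≥0} (hs : wck 𝕜 A < s)
    {Y : Submodule 𝕜 X} {x : ℕ → X} (hxA : ∀ n, x n ∈ A) (hxY : ∀ n, x n ∈ Y) :
    ∃ z ∈ clust 𝕜 x, ∃ v ∈ Y, ‖z - NormedSpace.inclusionInDoubleDual 𝕜 X v‖ < 2 * s := by
  have h : setDist (clust 𝕜 x) (Set.range (NormedSpace.inclusionInDoubleDual 𝕜 X)) < s :=
    (le_iSup₂_of_le x hxA le_rfl).trans_lt hs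
  obtain ⟨z, h'⟩ := iInf_lt_iff.1 h
  obtain ⟨hz, h''⟩ := iInf_lt_iff.1 h'
  obtain ⟨_, ⟨p, rfl⟩, hp⟩ := Metric.infEDist_lt_iff.1 h''
  rw [edist_nndist, ENNReal.coe_lt_coe, ← NNReal.coe_lt_coe, coe_nndist, dist_eq_norm] at hp
  obtain ⟨v, hv, hpv⟩ := exists_mem_norm_sub_lt hxY hz hp
  refine ⟨z, hz, v, hv, ?_⟩
  calc ‖z - NormedSpace.inclusionInDoubleDual 𝕜 X v‖
      ≤ ‖z - NormedSpace.inclusionInDoubleDual 𝕜 X p‖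
        + ‖NormedSpace.inclusionInDoubleDual 𝕜 X (p - v)‖ := by
        rw [map_sub]
        exact norm_sub_le_norm_sub_add_norm_sub z (NormedSpace.inclusionInDoubleDual 𝕜 X p) _
    _ < s + s := add_lt_add hp ((NormedSpace.double_dual_bound 𝕜 X (p - v)).trans_lt hpv)
    _ = 2 * s := by ring

/-- A separable set is normed by a countable family of functionals. -/
theorem exists_countable_norming {S : Set X} (hS : TopologicalSpace.IsSeparable S) :
    ∃ T : Set (StrongDual 𝕜 X), T.Countable ∧ (∀ f ∈ T, ‖f‖ ≤ 1) ∧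
      ∀ y ∈ S, ∀ M : ℝ, (∀ f ∈ T, ‖f y‖ ≤ M) → ‖y‖ ≤ M := by
  obtain ⟨t, -, ht, hSt⟩ := hS.exists_countable_dense_subset
  choose f hf hfx using fun x : X => exists_dual_vector'' 𝕜 x
  refine ⟨f '' t, ht.image f, Set.forall_mem_image.2 fun x _ => hf x, fun y hy M hM => ?_⟩
  refine le_of_forall_pos_le_add fun ε hε => ?_
  obtain ⟨w, hw, hyw⟩ := Metric.mem_closure_iff.1 (hSt hy) (ε / 2) (half_pos hε)
  rw [dist_eq_norm] at hyw
  have h₁ : ‖w‖ ≤ ‖f w y‖ + ‖y - w‖ := by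
    have : ‖w‖ = ‖f w w‖ := by simp [hfx]
    rw [this]
    calc ‖f w w‖ = ‖f w y - f w (y - w)‖ := by simp
      _ ≤ ‖f w y‖ + ‖f w (y - w)‖ := norm_sub_le _ _
      _ ≤ _ := by gcongr; exact ((f w).le_of_opNorm_le (hf w) _).trans_eq (one_mul _)
  have h₂ : ‖y‖ ≤ ‖w‖ + ‖y - w‖ := norm_le_insert' _ _
  have h₃ := hM (f w) (Set.mem_image_of_mem f hw)
  linarith

theorem exists_subseq_tendsto_apply {ι : Type*} [Countable ι] {f : ι → StrongDual 𝕜 X}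
    {x : ℕ → X} (hx : Bornology.IsBounded (Set.range x)) :
    ∃ φ : ℕ → ℕ, StrictMono φ ∧
      ∃ L : ι → 𝕜, ∀ i, Tendsto (fun n => f i (x (φ n))) atTop (𝓝 (L i)) := by
  obtain ⟨R, hR⟩ := isBounded_iff_forall_norm_le.1 hx
  have hcpt : IsCompact (Set.pi Set.univ fun i : ι => Metric.closedBall (0 : 𝕜) (‖f i‖ * R)) :=
    isCompact_univ_pi fun i => isCompact_closedBall _ _
  obtain ⟨L, -, φ, hφ, hL⟩ := hcpt.tendsto_subseq (x := fun n i => f i (x n)) fun n i _ =>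
    mem_closedBall_zero_iff.2 ((f i).le_of_opNorm_le_of_le le_rfl (hR _ ⟨n, rfl⟩))
  exact ⟨φ, hφ, L, fun i => (tendsto_pi_nhds.1 hL) i⟩

theorem exists_subseq_tendsto_of_lt_ca {u : ℕ → 𝕜} (hu : Bornology.IsBounded (Set.range u))
    {r : ℝ≥0∞} (hr : r < ca u) :
    ∃ (i j : ℕ → ℕ) (a b : 𝕜), Tendsto i atTop atTop ∧ Tendsto j atTop atTop ∧
      Tendsto (u ∘ i) atTop (𝓝 a) ∧ Tendsto (u ∘ j) atTop (𝓝 b) ∧ r ≤ edist a b := by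
  choose i hi j hj hij using exists_lt_edist_of_lt_ca hr
  have hcpt := (hu.isCompact_closure).prod hu.isCompact_closure
  obtain ⟨⟨a, b⟩, -, θ, hθ, hab⟩ := hcpt.tendsto_subseq (x := fun n => (u (i n), u (j n)))
    fun n => ⟨subset_closure ⟨_, rfl⟩, subset_closure ⟨_, rfl⟩⟩
  have ha : Tendsto (fun n => u (i (θ n))) atTop (𝓝 a) := (continuous_fst.tendsto _).comp hab
  have hb : Tendsto (fun n => u (j (θ n))) atTop (𝓝 b) := (continuous_snd.tendsto _).comp hab
  exact ⟨i ∘ θ, j ∘ θ, a, b, (tendsto_atTop_mono hi tendsto_id).comp hθ.tendsto_atTop,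
    (tendsto_atTop_mono hj tendsto_id).comp hθ.tendsto_atTop, ha, hb,
    ge_of_tendsto (ha.edist hb) (Eventually.of_forall fun n => (hij _).le)⟩

theorem betaW_le_wck {A : Set X} (hA : Bornology.IsBounded A) : betaW 𝕜 A ≤ 8 * wck 𝕜 A := by
  refine iSup₂_le fun x hx => ?_
  have h8 : (8 : ℝ≥0∞) ≠ 0 := by norm_num
  rw [mul_comm, ← ENNReal.div_le_iff_le_mul (Or.inl h8) (Or.inl ENNReal.ofNat_ne_top)]
  refine le_of_forall_gt_imp_ge_of_dense fun s hs => ?_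
  rw [ENNReal.div_le_iff_le_mul (Or.inl h8) (Or.inl ENNReal.ofNat_ne_top), mul_comm]
  induction s with
  | top => simp
  | coe s =>
  have hxb : Bornology.IsBounded (Set.range x) := hA.subset (Set.range_subset_iff.2 hx)
  -- The approximants `v`, `v'` of the cluster points are taken in this separable span, where the
  -- countable family `T` controls the norm.
  let Y : Submodule 𝕜 X := Submodule.span 𝕜 (Set.range x)
  have hxY : ∀ n, x n ∈ Y := fun n => Submodule.subset_span ⟨n, rfl⟩
  obtain ⟨T, hT, hf, hnorm⟩ := exists_countable_norming (𝕜 := 𝕜) (S := (Y : Set X))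
    ((Set.countable_range x).isSeparable.span)
  have := hT.to_subtype
  obtain ⟨φ, hφ, L, hL⟩ := exists_subseq_tendsto_apply
    (f := fun k : T => (k : StrongDual 𝕜 X)) hxb
  refine (iInf₂_le φ hφ).trans (iSup₂_le fun g hg => ?_)
  rw [mem_closedBall_zero_iff] at hg
  refine le_of_not_gt fun hlt => ?_
  obtain ⟨r, hr, hr'⟩ := exists_between hlt
  have hub : Bornology.IsBounded (Set.range fun n => g ((x ∘ φ) n)) := by
    refine (g.lipschitz.isBounded_image hxb).subset ?_
    rintro _ ⟨n, rfl⟩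
    exact ⟨_, ⟨φ n, rfl⟩, rfl⟩
  obtain ⟨i, j, a, b, hi, hj, ha, hb, hab⟩ := exists_subseq_tendsto_of_lt_ca hub hr'
  obtain ⟨z, hz, v, hv, hzv⟩ := exists_mem_clust_norm_sub_lt hs (Y := Y)
    (x := x ∘ φ ∘ i) (fun _ => hx _) (fun _ => hxY _)
  obtain ⟨z', hz', v', hv', hzv'⟩ := exists_mem_clust_norm_sub_lt hs (Y := Y)
    (x := x ∘ φ ∘ j) (fun _ => hx _) (fun _ => hxY _)
  have hbound : ∀ {z : StrongDual 𝕜 (StrongDual 𝕜 X)} {v : X} {h : StrongDual 𝕜 X},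
      ‖z - NormedSpace.inclusionInDoubleDual 𝕜 X v‖ < 2 * s → ‖h‖ ≤ 1 → dist (z h) (h v) ≤ 2 * s :=
    fun {z v h} hz hh => by
      rw [dist_eq_norm]
      exact (ContinuousLinearMap.le_of_opNorm_le_of_le
        (z - NormedSpace.inclusionInDoubleDual 𝕜 X v) hz.le hh).trans_eq (mul_one _)
  -- Both cluster points take the value `L k` at `k ∈ T`, so `k v` and `k v'` each lie within `2 *
  -- s` of it.
  have hvv : ‖v - v'‖ ≤ 4 * s := hnorm _ (Y.sub_mem hv hv') _ fun k hk => by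
    have h₁ : z k = L ⟨k, hk⟩ := eq_of_mem_clust_of_tendsto hz ((hL ⟨k, hk⟩).comp hi)
    have h₂ : z' k = L ⟨k, hk⟩ := eq_of_mem_clust_of_tendsto hz' ((hL ⟨k, hk⟩).comp hj)
    have h₃ := hbound hzv (hf k hk)
    have h₄ := hbound hzv' (hf k hk)
    rw [h₁] at h₃
    rw [h₂] at h₄
    rw [map_sub, ← dist_eq_norm]
    linarith [dist_triangle_left (k v) (k v') (L ⟨k, hk⟩)]
  have hza : z g = a := eq_of_mem_clust_of_tendsto hz ha
  have hzb : z' g = b := eq_of_mem_clust_of_tendsto hz' hb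
  -- The constant is `8 = 2 + 4 + 2`, along the path `a`, `g v`, `g v'`, `b`.
  have hdist : dist a b ≤ 8 * s := by
    have h₁ := hbound hzv hg
    have h₂ := hbound hzv' hg
    have h₃ : dist (g v) (g v') ≤ 4 * s := by
      rw [dist_eq_norm, ← map_sub]
      exact ((g.le_of_opNorm_le hg _).trans_eq (one_mul _)).trans hvv
    rw [hza] at h₁
    rw [hzb, dist_comm] at h₂
    linarith [dist_triangle4 a (g v) (g v') b]
  refine (hr.trans_le hab).not_ge ?_
  rw [edist_nndist]
  have : nndist a b ≤ 8 * s := by exact_mod_cast hdist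
  exact_mod_cast this

theorem HasSchurConst.equivalent {c : ℝ≥0} (hc : 0 < c) (h : HasSchurConst 𝕜 X c)
    {p q : Set X → ℝ≥0∞}
    (hp : ∀ A, Bornology.IsBounded A → betaW 𝕜 A ≤ 8 * p A ∧ p A ≤ 8 * hausdorffMeasure A)
    (hq : ∀ A, Bornology.IsBounded A → betaW 𝕜 A ≤ 8 * q A ∧ q A ≤ 8 * hausdorffMeasure A) :
    Equivalent p q := by
  -- The constant `64 * c` comes from `a ≤ 8 * χ`, `χ ≤ c * β_w` and `β_w ≤ 8 * b`.
  have key : ∀ {A : Set X}, Bornology.IsBounded A → ∀ {a b : ℝ≥0∞},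
      a ≤ 8 * hausdorffMeasure A → betaW 𝕜 A ≤ 8 * b → a ≤ ((64 * c : ℝ≥0) : ℝ≥0∞) * b := by
    intro A hA a b ha hb
    calc a ≤ 8 * (c * (8 * b)) := ha.trans (by
          gcongr
          exact (h.hausdorffMeasure_le_betaW hc hA).trans (by gcongr))
      _ = ((64 * c : ℝ≥0) : ℝ≥0∞) * b := by push_cast; ring
  exact ⟨64 * c, by positivity, fun A hA =>
    ⟨key hA (hp A hA).2 (hq A hA).1, key hA (hq A hA).2 (hp A hA).1⟩⟩

end QuantSchur

theorem mainTheorem11 {𝕜 : Type*} [RCLike 𝕜] {X : Type*} [NormedAddCommGroup X]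
    [NormedSpace 𝕜 X] [CompleteSpace X] :
    (QuantSchur.Equivalent (QuantSchur.betaW 𝕜 (X := X)) (QuantSchur.wck 𝕜) ∧
      QuantSchur.Equivalent (QuantSchur.betaW 𝕜 (X := X)) (QuantSchur.deBlasi 𝕜) ∧
      QuantSchur.Equivalent (QuantSchur.betaW 𝕜 (X := X)) QuantSchur.hausdorffMeasure ∧
      QuantSchur.Equivalent (QuantSchur.wck 𝕜 (X := X)) (QuantSchur.deBlasi 𝕜) ∧
      QuantSchur.Equivalent (QuantSchur.wck 𝕜 (X := X)) QuantSchur.hausdorffMeasure ∧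
      QuantSchur.Equivalent (QuantSchur.deBlasi 𝕜 (X := X)) QuantSchur.hausdorffMeasure) ↔
    QuantSchur.HasQuantitativeSchur 𝕜 X := by
  refine ⟨fun h => QuantSchur.hasQuantitativeSchur_of_equivalent h.2.2.1, ?_⟩
  rintro ⟨c, hc, h⟩
  have le_eight : ∀ a : ENNReal, a ≤ 8 * a := fun a => le_mul_of_one_le_left' (by norm_num)
  have hω : ∀ A : Set X, QuantSchur.deBlasi 𝕜 A ≤ 8 * QuantSchur.hausdorffMeasure A := fun A =>
    (QuantSchur.deBlasi_le_hausdorffMeasure A).trans (le_eight _)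
  have hβω : ∀ A : Set X, Bornology.IsBounded A →
      QuantSchur.betaW 𝕜 A ≤ 8 * QuantSchur.deBlasi 𝕜 A := fun A hA =>
    (QuantSchur.betaW_le_wck hA).trans (by gcongr; exact QuantSchur.wck_le_deBlasi hA)
  have hβχ : ∀ A : Set X, Bornology.IsBounded A →
      QuantSchur.betaW 𝕜 A ≤ 8 * QuantSchur.hausdorffMeasure A := fun A hA =>
    (hβω A hA).trans (by gcongr; exact QuantSchur.deBlasi_le_hausdorffMeasure A)
  have hβ := fun (A : Set X) (hA : Bornology.IsBounded A) =>
    And.intro (le_eight (QuantSchur.betaW 𝕜 A)) (hβχ A hA)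
  have hw := fun (A : Set X) (hA : Bornology.IsBounded A) =>
    And.intro (QuantSchur.betaW_le_wck (𝕜 := 𝕜) hA) ((QuantSchur.wck_le_deBlasi hA).trans (hω A))
  have ho := fun (A : Set X) (hA : Bornology.IsBounded A) => And.intro (hβω A hA) (hω A)
  have hχ := fun (A : Set X) (hA : Bornology.IsBounded A) =>
    And.intro (hβχ A hA) (le_eight (QuantSchur.hausdorffMeasure A))
  exact ⟨h.equivalent hc hβ hw, h.equivalent hc hβ ho, h.equivalent hc hβ hχ,
    h.equivalent hc hw ho, h.equivalent hc hw hχ, h.equivalent hc ho hχ⟩
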